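/- Let $G=(V,E)$ be a known finite directed graph with $n$ nodes and $m$ edges, and write $N(v)$ for the set of in-neighbors of a node $v$. In the Discrete-Time Linear Threshold (DLT) model with edge weights $w=(w_{u,v})_{(u,v)\in E}$, every node $v$ has an independent threshold $\theta_v$, uniform on $[0,1]$; starting from a seed set $A_0=S\subseteq V$, a node $v$ becomes (and stays) active at step $t$ if $\sum_{u\in N(v)\cap A_{t-1}}w_{u,v}\ge\theta_v$, where $A_{t-1}$ is the set of nodes active by step $t-1$. Let $A$ be the set of nodes that are eventually active. The influence function of $w$ is $F^w:2^V\to[0,1]^V$, $F^w_v(S)=\Pr[v\in A\mid S]$. Let $\lambda\in(0,\tfrac12)$, and let $\mathcal F_\lambda$ be the class of all $F^w$ such that $w_{u,v}\in[\lambda,1-\lambda]$ for every edge $(u,v)$ and $1-\sum_{u\in N(v)}w_{u,v}\in[\lambda,1-\lambda]$ for every node $v$ with $N(v)\neq\emptyset$. Let $r\in(0,1]$ be a known retention rate. An incomplete cascade is a pair $(S,\tilde A)$, where $S$ is drawn from a distribution $\mathcal P$ on $2^V$, $A$ is the final active set of a diffusion from $S$, and $\tilde A\supseteq S$ contains each $v\in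 A\setminus S$ independently with probability $r$ and no other node outside $S$. For $F:2^V\to\mathbb R^V$ let $\mathrm{err}(F)=\mathbb E_{S,A}\big[\tfrac1n\|\mathbf 1_A-F(S)\|_2^2\big]$, where $S\sim\mathcal P$ and $A$ is the complete final active set of the true model. Then $\mathcal F_\lambda$ is properly PAC learnable from incomplete cascades with retention rate $r$, with sample complexity $\tilde O\!\left(\frac{n^3m}{\varepsilon^2r^4}\right)$. That is, there are absolute constants $C>0$ and $k\in\mathbb N$ such that for all $G$, $\lambda$ and $r$ as above there is a learning algorithm (a map from finite sequences of incomplete cascades to functions, always returning an element of $\mathcal F_\lambda$ provided that $\mathcal F_\lambda\ne\emptyset$) with the following property: for all $\varepsilon,\delta\in(0,1)$, all true influence functions $F^*=F^w\in\mathcal F_\lambda$ (given by weights $w$ satisfying the constraints above), all distributions $\mathcal P$ on $2^V$, and all $$M\;\ge\;C\,\frac{n^3m}{\varepsilon^2r^4}\,\log^k\!\Big(2+n+m+\frac1\varepsilon+\frac1\delta+\frac1r\Big),$$ the output $F$ of the algorithm on $M$ independent incomplete cascades satisfies $\Pr\big[\mathrm{err}(F)-\mathrm{err}(F^*)\ge\varepsilon\big]\le\delta$.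 -/

import Mathlib

open MeasureTheory

namespace DLT

section Model

variable {V : Type*} [Fintype V] [DecidableEq V]

open Classical in
/-- The in-neighbours `N(v)` of a node; `G.Adj u v` says that `(u, v)` is a directed edge. -/
noncomputable def inNeighbors (G : Digraph V) (v : V) : Finset V :=
  Finset.univ.filter fun u => G.Adj u v

open Classical in
/-- The number `m` of directed edges. -/
noncomputable def numEdges (G : Digraph V) : ℕ :=
  (Finset.univ.filter fun e : V × V => G.Adj e.1 e.2).card

open Classical in
/-- The set of nodes active at time `t`, for edge weights `w`, seed set `S` and thresholds `θ`. -/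
noncomputable def activeAt (G : Digraph V) (w : V → V → ℝ) (S : Finset V) (θ : V → ℝ) :
    ℕ → Finset V
  | 0 => S
  | t + 1 =>
      activeAt G w S θ t ∪
        Finset.univ.filter fun v =>
          θ v ≤ ∑ u ∈ inNeighbors G v ∩ activeAt G w S θ t, w u v

open Classical in
/-- The set of nodes that are active at the end of the diffusion. -/
noncomputable def finalActive (G : Digraph V) (w : V → V → ℝ) (S : Finset V) (θ : V → ℝ) :
    Finset V :=
  Finset.univ.filter fun v => ∃ t, v ∈ activeAt G w S θ t

/-- Independent thresholds, each uniform on `[0, 1]`. -/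
noncomputable def thresholdLaw (V : Type*) [Fintype V] : Measure (V → ℝ) :=
  Measure.pi fun _ => volume.restrict (Set.Icc (0 : ℝ) 1)

instance instIsProbabilityMeasureUniform :
    IsProbabilityMeasure (volume.restrict (Set.Icc (0 : ℝ) 1)) :=
  ⟨by simp⟩

instance instIsProbabilityMeasureThresholdLaw : IsProbabilityMeasure (thresholdLaw V) := by
  unfold thresholdLaw; infer_instance

theorem measurable_activeAt (G : Digraph V) (w : V → V → ℝ) (S : Finset V) (t : ℕ) :
    Measurable fun θ => activeAt G w S θ t := by
  induction t with
  | zero => exact measurable_const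
  | succ t ih =>
    refine measurable_finset_iff.2 fun v => measurableSet_setOfPred.1 ?_
    have h1 : MeasurableSet {θ : V → ℝ | v ∈ activeAt G w S θ t} :=
      ih (MeasurableSet.of_discrete (s := {A : Finset V | v ∈ A}))
    have h2 : Measurable fun θ : V → ℝ => ∑ u ∈ inNeighbors G v ∩ activeAt G w S θ t, w u v :=
      (Measurable.of_discrete
        (f := fun A : Finset V => ∑ u ∈ inNeighbors G v ∩ A, w u v)).comp ih
    have h3 := measurableSet_le (measurable_pi_apply v) h2
    simpa [activeAt, Set.ofPred_or] using h1.union h3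

theorem measurable_finalActive (G : Digraph V) (w : V → V → ℝ) (S : Finset V) :
    Measurable (finalActive G w S) := by
  refine measurable_finset_iff.2 fun v => measurableSet_setOfPred.1 ?_
  have : {θ : V → ℝ | v ∈ finalActive G w S θ} = ⋃ t, {θ | v ∈ activeAt G w S θ t} := by
    ext θ; simp [finalActive]
  rw [this]
  exact MeasurableSet.iUnion fun t =>
    measurable_activeAt G w S t (MeasurableSet.of_discrete (s := {A : Finset V | v ∈ A}))

/-- The distribution of the final active set when the seed set is `S`. -/
noncomputable def actDist (G : Digraph V) (w : V → V → ℝ) (S : Finset V) : PMF (Finset V) :=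
  haveI : IsProbabilityMeasure ((thresholdLaw V).map (finalActive G w S)) :=
    Measure.isProbabilityMeasure_map (measurable_finalActive G w S).aemeasurable
  ((thresholdLaw V).map (finalActive G w S)).toPMF

/-- The influence function: `influence G w S v` is the probability that `v` is activated when the
seed set is `S`. -/
noncomputable def influence (G : Digraph V) (w : V → V → ℝ) (S : Finset V) (v : V) : ℝ :=
  ((actDist G w S).toMeasure {A | v ∈ A}).toReal

/-- The edge weights of the class: every weight lies in `[lam, 1 - lam]`, and so does the slack
`1 - ∑ u ∈ N(v), w u v` of every node that has an in-neighbour (for a node without in-neighbours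
the slack is the constant `1`). The values of `w` off the edges are irrelevant. -/
def admissible (G : Digraph V) (lam : ℝ) : Set (V → V → ℝ) :=
  {w | (∀ u v, G.Adj u v → w u v ∈ Set.Icc lam (1 - lam)) ∧
    ∀ v, (inNeighbors G v).Nonempty →
      1 - ∑ u ∈ inNeighbors G v, w u v ∈ Set.Icc lam (1 - lam)}

/-- Independent observation coins, one for each node, with success probability `r`. -/
noncomputable def coinLaw (V : Type*) [Fintype V] (r : unitInterval) : PMF (V → Bool) :=
  (Measure.pi fun _ : V => ProbabilityTheory.bernoulliMeasure true false r).toPMF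

/-- The distribution of the observed set: seeds are always observed, and every other active node is
observed independently with probability `r`. -/
noncomputable def obsDist (r : unitInterval) (S A : Finset V) : PMF (Finset V) :=
  (coinLaw V r).map fun b => S ∪ (A \ S).filter fun v => b v = true

/-- The distribution of one incomplete cascade (seed set, observed set), with the seed set drawn
from `P`. -/
noncomputable def incompleteCascade (G : Digraph V) (w : V → V → ℝ) (r : unitInterval)
    (P : PMF (Finset V)) : PMF (Finset V × Finset V) :=
  P.bind fun S => (actDist G w S).bind fun A => (obsDist r S A).map fun B => (S, B)

/-- The law of `M` independent incomplete cascades. -/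
noncomputable def trainingLaw (G : Digraph V) (w : V → V → ℝ) (r : unitInterval)
    (P : PMF (Finset V)) (M : ℕ) : Measure (Fin M → Finset V × Finset V) :=
  Measure.pi fun _ => (incompleteCascade G w r P).toMeasure

/-- The quadratic loss `(1 / n) ‖x - y‖₂ ^ 2`. -/
noncomputable def sqLoss (x y : V → ℝ) : ℝ :=
  1 / (Fintype.card V : ℝ) * ∑ v, (x v - y v) ^ 2

/-- Expectation under a distribution on a finite set. -/
noncomputable def expect {α : Type*} [Fintype α] (p : PMF α) (f : α → ℝ) : ℝ :=
  ∑ a, (p a).toReal * f a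

/-- The squared error of `F` when the true weights are `w`; the complete active set enters. -/
noncomputable def errSq (G : Digraph V) (w : V → V → ℝ) (P : PMF (Finset V))
    (F : Finset V → V → ℝ) : ℝ :=
  expect P fun S => expect (actDist G w S) fun A =>
    sqLoss (fun v => if v ∈ A then 1 else 0) (F S)

/-- The influence functions with weights in `W` are properly PAC learnable from incomplete cascades
with retention rate `r`, and `M₀ ε δ` cascades suffice for accuracy `ε` and confidence `1 - δ`.
The learner knows the graph, `W` and `r`, but neither `ε`, `δ`, the true weights nor `P`. (If `W` is
empty there is no function that it could return and nothing to learn.) -/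
def ProperlyPACLearnable (G : Digraph V) (W : Set (V → V → ℝ)) (r : unitInterval)
    (M₀ : ℝ → ℝ → ℝ) : Prop :=
  ∃ learner : (M : ℕ) → (Fin M → Finset V × Finset V) → (Finset V → V → ℝ),
    (W.Nonempty → ∀ M Z, learner M Z ∈ influence G '' W) ∧
    ∀ ε ∈ Set.Ioo (0 : ℝ) 1, ∀ δ ∈ Set.Ioo (0 : ℝ) 1, ∀ w ∈ W, ∀ P : PMF (Finset V),
      ∀ M : ℕ, M₀ ε δ ≤ M →
        trainingLaw G w r P M
          {Z | errSq G w P (learner M Z) - errSq G w P (influence G w) ≥ ε} ≤ ENNReal.ofReal δ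

end Model

end DLT

namespace DLT

/-! ### Finite expectations. -/

section Expectation

variable {α β : Type*} [Fintype α] [Fintype β]

/-! The learner is empirical risk minimisation for `obsLoss`, in which the observed indicator of a
non-seed node is divided by `r`. The square of that indicator does not depend on the candidate, so a
difference of two losses is affine in the indicator. Its mean is therefore exactly the difference of
the true errors (`expect_incompleteCascade_obsLoss_sub`), although the loss itself is a biased
estimate. Seed terms may be dropped because every influence function equals 1 there.

Such a difference lies in `[-2/r, 2/r]`, so Hoeffding's inequality controls one candidate. For
uniformity over the class, weights are rounded to a grid of mesh `1/K`. Coupling two diffusions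
through common thresholds shows that influence is Lipschitz in the weights with constant `n² 2ⁿ`
(`abs_influence_sub_le`). This constant is exponential, but the net has `(K + 1) ^ m` elements and
only its logarithm, of order `n m log X` with `X` the argument of the logarithm in the sample bound,
enters. Hence `n m log X / (ε² r²)` cascades suffice up to a constant, which the stated bound
dominates. -/

theorem expect_eq_integral [MeasurableSpace α] [MeasurableSingletonClass α] (p : PMF α)
    (f : α → ℝ) : expect p f = ∫ a, f a ∂p.toMeasure := by
  simp [expect, PMF.integral_eq_sum]

theorem sum_toReal_eq_one (p : PMF α) : ∑ a, (p a).toReal = 1 := by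
  rw [← ENNReal.toReal_sum fun a _ => p.apply_ne_top a, ← tsum_fintype (L := .unconditional α),
    p.tsum_coe, ENNReal.toReal_one]

theorem expect_bind (p : PMF α) (q : α → PMF β) (f : β → ℝ) :
    expect (p.bind q) f = expect p fun a => expect (q a) f := by
  have h (b : β) : ((p.bind q) b).toReal = ∑ a, (p a).toReal * (q a b).toReal := by
    rw [PMF.bind_apply, tsum_fintype, ENNReal.toReal_sum]
    · simp
    · exact fun a _ => ENNReal.mul_ne_top (p.apply_ne_top a) ((q a).apply_ne_top b)
  simp only [expect, h, Finset.sum_mul, Finset.mul_sum]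
  rw [Finset.sum_comm]
  simp only [mul_assoc]

theorem expect_pure (a : α) (f : α → ℝ) : expect (PMF.pure a) f = f a := by
  classical
  rw [expect, Finset.sum_eq_single a]
  · simp
  · intro b _ hb
    simp [PMF.pure_apply, hb]
  · simp

theorem expect_map (p : PMF α) (g : α → β) (f : β → ℝ) :
    expect (p.map g) f = expect p fun a => f (g a) := by
  rw [← PMF.bind_pure_comp, expect_bind]
  simp [expect_pure]

theorem expect_sub (p : PMF α) (f g : α → ℝ) :
    expect p (fun a => f a - g a) = expect p f - expect p g := by
  simp [expect, mul_sub]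

theorem expect_const_mul (p : PMF α) (c : ℝ) (f : α → ℝ) :
    expect p (fun a => c * f a) = c * expect p f := by
  simp only [expect, Finset.mul_sum]
  exact Finset.sum_congr rfl fun _ _ => by ring

theorem expect_const (p : PMF α) (c : ℝ) : expect p (fun _ => c) = c := by
  rw [expect, ← Finset.sum_mul, sum_toReal_eq_one, one_mul]

theorem expect_sum {ι : Type*} (p : PMF α) (s : Finset ι) (f : ι → α → ℝ) :
    expect p (fun a => ∑ i ∈ s, f i a) = ∑ i ∈ s, expect p (f i) := by
  simp only [expect, Finset.mul_sum]
  exact Finset.sum_comm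

theorem expect_mono (p : PMF α) {f g : α → ℝ} (h : ∀ a, f a ≤ g a) : expect p f ≤ expect p g :=
  Finset.sum_le_sum fun a _ => mul_le_mul_of_nonneg_left (h a) ENNReal.toReal_nonneg

theorem expect_le_expect_add (p : PMF α) {f g : α → ℝ} {c : ℝ} (h : ∀ a, f a ≤ g a + c) :
    expect p f ≤ expect p g + c := by
  have h' := expect_mono p fun a => sub_le_iff_le_add.2 (h a)
  rw [expect_sub, expect_const] at h'
  linarith

end Expectation

/-! ### The corrected loss and its unbiased differences. -/

section Loss

variable {V : Type*} [Fintype V] [DecidableEq V]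

/-- The loss of `F` on an incomplete cascade: the quadratic loss at the nodes outside the seed set,
with the observed indicator rescaled by the inverse retention rate. -/
noncomputable def obsLoss (r : ℝ) (F : Finset V → V → ℝ) (z : Finset V × Finset V) : ℝ :=
  1 / (Fintype.card V : ℝ) *
    ∑ v, if v ∈ z.1 then 0 else ((if v ∈ z.2 then 1 else 0) / r - F z.1 v) ^ 2

theorem expect_coinLaw (r : unitInterval) (v : V) :
    expect (coinLaw V r) (fun b => if b v = true then 1 else 0) = (r : ℝ) := by
  rw [expect_eq_integral, coinLaw, Measure.toPMF_toMeasure,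
    integral_comp_eval (μ := fun _ : V => ProbabilityTheory.bernoulliMeasure true false r)
      (f := fun b : Bool => if b = true then (1 : ℝ) else 0)
      (Measurable.of_discrete.aestronglyMeasurable)]
  simp [ProbabilityTheory.integral_bernoulliMeasure]

theorem expect_obsDist_indicator (r : unitInterval) {S : Finset V} (A : Finset V) {v : V}
    (hv : v ∉ S) :
    expect (obsDist r S A) (fun B => if v ∈ B then 1 else 0) =
      (r : ℝ) * if v ∈ A then 1 else 0 := by
  rw [obsDist, expect_map]
  by_cases hA : v ∈ A
  · simp [hv, hA, expect_coinLaw]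
  · simp [hv, hA, expect_const]

/-- Given the complete active set, the difference of the losses on the incomplete cascade is an
unbiased estimate of the difference of the quadratic losses. -/
theorem expect_obsDist_obsLoss_sub {r : unitInterval} (hr : 0 < (r : ℝ)) (S A : Finset V)
    {F F' : Finset V → V → ℝ} (hF : ∀ v ∈ S, F S v = F' S v) :
    expect (obsDist r S A) (fun B => obsLoss r F (S, B) - obsLoss r F' (S, B)) =
      sqLoss (fun v => if v ∈ A then 1 else 0) (F S) -
        sqLoss (fun v => if v ∈ A then 1 else 0) (F' S) := by
  simp only [obsLoss, sqLoss, ← mul_sub, ← Finset.sum_sub_distrib]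
  rw [expect_const_mul, expect_sum]
  congr 1
  refine Finset.sum_congr rfl fun v _ => ?_
  by_cases hv : v ∈ S
  · simp [hv, hF v hv, expect_const]
  -- The squared rescaled indicators cancel; what remains is affine in the indicator.
  · have h (B : Finset V) : (if v ∈ S then (0 : ℝ) else
          ((if v ∈ B then 1 else 0) / (r : ℝ) - F S v) ^ 2) -
        (if v ∈ S then 0 else ((if v ∈ B then 1 else 0) / (r : ℝ) - F' S v) ^ 2) =
        (2 * (F' S v - F S v) / r) * (if v ∈ B then 1 else 0) -
          (F' S v ^ 2 - F S v ^ 2) := by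
      simp only [hv, if_false]; ring
    simp only [h]
    rw [expect_sub, expect_const_mul, expect_const, expect_obsDist_indicator r A hv]
    have : (2 * (F' S v - F S v) / r) * ((r : ℝ) * if v ∈ A then 1 else 0) =
        2 * (F' S v - F S v) * if v ∈ A then 1 else 0 := by
      field_simp
    rw [this]
    ring

theorem expect_incompleteCascade_obsLoss_sub (G : Digraph V) (w : V → V → ℝ)
    {r : unitInterval} (hr : 0 < (r : ℝ)) (P : PMF (Finset V)) {F F' : Finset V → V → ℝ}
    (hF : ∀ S, ∀ v ∈ S, F S v = F' S v) :
    expect (incompleteCascade G w r P) (fun z => obsLoss r F z - obsLoss r F' z) =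
      errSq G w P F - errSq G w P F' := by
  simp only [errSq, ← expect_sub, ← expect_obsDist_obsLoss_sub hr _ _ (hF _), incompleteCascade,
    expect_bind, expect_map]

/-- Factor the difference of squares: one factor is at most `τ`, the other, `2a - F - F'` with `a ∈
{0, 1/r}`, at most `2/r`. Used with small `τ` for the rounding error and with `τ = 1` for the range
in Hoeffding's inequality. -/
theorem abs_obsLoss_sub_le {r : ℝ} (hr : 0 < r) (hr1 : r ≤ 1) {F F' : Finset V → V → ℝ}
    (hF : ∀ S v, F S v ∈ Set.Icc (0 : ℝ) 1) (hF' : ∀ S v, F' S v ∈ Set.Icc (0 : ℝ) 1) {τ : ℝ}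
    (hτ : 0 ≤ τ)
    (h : ∀ S v, |F S v - F' S v| ≤ τ) (z : Finset V × Finset V) :
    |obsLoss r F z - obsLoss r F' z| ≤ τ * (2 / r) := by
  have hr2 : 1 ≤ 1 / r := by rw [le_div_iff₀ hr]; linarith
  have e2 : 2 / r = 2 * (1 / r) := by ring
  rcases isEmpty_or_nonempty V with hV | ⟨⟨v₀⟩⟩
  · simp only [obsLoss, Finset.univ_eq_empty, Finset.sum_empty, mul_zero, sub_zero, abs_zero]
    positivity
  have key : |∑ v, ((if v ∈ z.1 then 0 else ((if v ∈ z.2 then 1 else 0) / r - F z.1 v) ^ 2) -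
      (if v ∈ z.1 then 0 else ((if v ∈ z.2 then 1 else 0) / r - F' z.1 v) ^ 2))| ≤
      ∑ _v : V, τ * (2 / r) := by
    refine (Finset.abs_sum_le_sum_abs _ _).trans (Finset.sum_le_sum fun v _ => ?_)
    by_cases hv : v ∈ z.1
    · simp only [hv, if_true, sub_zero, abs_zero]; positivity
    have h1 := hF z.1 v
    have h2 := hF' z.1 v
    simp only [Set.mem_Icc] at h1 h2
    rw [if_neg hv, if_neg hv, sq_sub_sq, mul_comm, abs_mul]
    refine mul_le_mul ?_ ?_ (abs_nonneg _) hτ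
    · rw [sub_sub_sub_cancel_left, abs_sub_comm]; exact h z.1 v
    · rw [abs_le, e2]
      split_ifs <;> constructor <;> (try simp only [zero_div]) <;> linarith
  simp only [Finset.sum_const, Finset.card_univ, nsmul_eq_mul] at key
  rw [obsLoss, obsLoss, ← mul_sub, ← Finset.sum_sub_distrib, abs_mul]
  have hn : (0 : ℝ) < Fintype.card V := by
    have := Fintype.card_pos_iff.2 ⟨v₀⟩
    exact_mod_cast this
  rw [abs_of_pos (by positivity), div_mul_eq_mul_div, one_mul, div_le_iff₀ hn]
  linarith

end Loss

/-! ### Influence functions and their dependence on the weights. -/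

section Influence

theorem thresholdLaw_real_uIcc_le {V : Type*} [Fintype V] (v : V) (a b : ℝ) :
    (thresholdLaw V).real {θ | θ v ∈ Set.uIcc a b} ≤ |b - a| := by
  have h := (measurePreserving_eval
    (fun _ : V => volume.restrict (Set.Icc (0 : ℝ) 1)) v).measureReal_preimage
      (s := Set.uIcc a b) measurableSet_uIcc.nullMeasurableSet
  refine (le_of_eq h).trans ?_
  rw [measureReal_def]
  refine ENNReal.toReal_le_of_le_ofReal (abs_nonneg _) ?_
  exact (Measure.restrict_apply_le _ _).trans (Real.volume_interval).le

variable {V : Type*} [Fintype V] [DecidableEq V]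

theorem influence_eq_measureReal (G : Digraph V) (w : V → V → ℝ) (S : Finset V) (v : V) :
    influence G w S v = (thresholdLaw V).real {θ | v ∈ finalActive G w S θ} := by
  have : IsProbabilityMeasure ((thresholdLaw V).map (finalActive G w S)) :=
    Measure.isProbabilityMeasure_map (measurable_finalActive G w S).aemeasurable
  rw [influence, actDist, Measure.toPMF_toMeasure,
    Measure.map_apply (measurable_finalActive G w S) MeasurableSet.of_discrete]
  rfl

theorem influence_mem_Icc (G : Digraph V) (w : V → V → ℝ) (S : Finset V) (v : V) :
    influence G w S v ∈ Set.Icc (0 : ℝ) 1 := by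
  rw [influence_eq_measureReal]
  exact ⟨measureReal_nonneg, measureReal_le_one⟩

theorem influence_of_mem (G : Digraph V) (w : V → V → ℝ) {S : Finset V} {v : V} (hv : v ∈ S) :
    influence G w S v = 1 := by
  have h : {θ : V → ℝ | v ∈ finalActive G w S θ} = Set.univ :=
    Set.eq_univ_of_forall fun θ => by
      simp only [finalActive, Set.mem_ofPred_eq, Finset.mem_filter, Finset.mem_univ, true_and]
      exact ⟨0, hv⟩
  rw [influence_eq_measureReal, h, probReal_univ]

/-- Two weights that compare to the thresholds in the same way give the same diffusion. -/
theorem finalActive_congr (G : Digraph V) {w w' : V → V → ℝ} (S : Finset V) {θ : V → ℝ}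
    (h : ∀ v B, θ v ≤ ∑ u ∈ inNeighbors G v ∩ B, w u v ↔
      θ v ≤ ∑ u ∈ inNeighbors G v ∩ B, w' u v) :
    finalActive G w S θ = finalActive G w' S θ := by
  have ht (t : ℕ) : activeAt G w S θ t = activeAt G w' S θ t := by
    induction t with
    | zero => rfl
    | succ t ih =>
      ext v
      simp [activeAt, ih, h]
  ext v
  simp [finalActive, ht]

/-- The influence function is Lipschitz in the weights. -/
theorem abs_influence_sub_le (G : Digraph V) {w w' : V → V → ℝ} {η : ℝ} (hη : 0 ≤ η)
    (hw : ∀ u v, G.Adj u v → |w u v - w' u v| ≤ η) (S : Finset V) (v : V) :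
    |influence G w S v - influence G w' S v| ≤
      (Fintype.card V : ℝ) ^ 2 * 2 ^ Fintype.card V * η := by
  classical
  set n := Fintype.card V
  -- Bad events: the threshold of a node separates its two weight sums over `B`. Taking all `B`
  -- avoids the dependence of the active set on the thresholds, at the price of the factor `2ⁿ`.
  set D : V × Finset V → Set (V → ℝ) := fun p =>
    {θ | θ p.1 ∈ Set.uIcc (∑ u ∈ inNeighbors G p.1 ∩ p.2, w u p.1)
      (∑ u ∈ inNeighbors G p.1 ∩ p.2, w' u p.1)} with hD
  -- Kept general in the pair of weights, so that swapping them gives the other half of the absolute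
  -- value.
  have hsub {w₁ w₂ : V → V → ℝ} (h : ∀ θ, θ ∉ ⋃ p, D p →
      finalActive G w₁ S θ = finalActive G w₂ S θ) :
      (thresholdLaw V).real {θ | v ∈ finalActive G w₁ S θ} ≤
        (thresholdLaw V).real {θ | v ∈ finalActive G w₂ S θ} +
          (thresholdLaw V).real (⋃ p, D p) := by
    refine (measureReal_mono fun θ hθ => ?_).trans (measureReal_union_le _ _)
    by_cases hp : θ ∈ ⋃ p, D p
    · exact Or.inr hp
    · exact Or.inl (by rw [Set.mem_ofPred_eq, ← h θ hp]; exact hθ)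
  have hcongr (θ : V → ℝ) (hθ : θ ∉ ⋃ p, D p) :
      finalActive G w S θ = finalActive G w' S θ := by
    refine finalActive_congr G S fun v B => ?_
    have h : θ v ∉ Set.uIcc (∑ u ∈ inNeighbors G v ∩ B, w u v)
        (∑ u ∈ inNeighbors G v ∩ B, w' u v) := fun h => hθ (Set.mem_iUnion.2 ⟨(v, B), h⟩)
    rw [Set.mem_uIcc] at h
    grind
  have hDle (p : V × Finset V) : (thresholdLaw V).real (D p) ≤ n * η := by
    refine (thresholdLaw_real_uIcc_le p.1 _ _).trans ?_
    rw [← Finset.sum_sub_distrib]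
    refine (Finset.abs_sum_le_sum_abs _ _).trans ?_
    refine (Finset.sum_le_card_nsmul _ _ η fun u hu => ?_).trans ?_
    · rw [abs_sub_comm]
      refine hw u p.1 ?_
      simpa [inNeighbors] using (Finset.mem_inter.1 hu).1
    · rw [nsmul_eq_mul]
      gcongr
      exact Finset.card_le_univ _
  have hU : (thresholdLaw V).real (⋃ p, D p) ≤ (n : ℝ) ^ 2 * 2 ^ n * η := by
    refine (measureReal_iUnion_fintype_le D).trans ?_
    refine (Finset.sum_le_sum fun p _ => hDle p).trans (le_of_eq ?_)
    simp only [Finset.sum_const, Finset.card_univ, Fintype.card_prod, Fintype.card_finset,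
      nsmul_eq_mul]
    push_cast
    ring
  rw [influence_eq_measureReal, influence_eq_measureReal, abs_le]
  have h1 := hsub hcongr
  have h2 := hsub fun θ hθ => (hcongr θ hθ).symm
  constructor <;> linarith

end Influence

/-- **Hoeffding's inequality** for the lower tail of an empirical sum. -/
theorem measureReal_pi_sum_add_le {α : Type*} [Fintype α] [MeasurableSpace α]
    [DiscreteMeasurableSpace α] (q : PMF α) {f : α → ℝ} {b : ℝ} (hb : 0 < b)
    (hf : ∀ a, |f a| ≤ b) (M : ℕ) {s : ℝ} (hs : 0 ≤ s) :
    (Measure.pi fun _ : Fin M => q.toMeasure).real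
      {Z | ∑ i, f (Z i) + M * s ≤ M * expect q f} ≤ Real.exp (-(M * s ^ 2) / (2 * b ^ 2)) := by
  have hsub (i : Fin M) : ProbabilityTheory.HasSubgaussianMGF
      (fun Z : Fin M → α => -f (Z i) - ∫ Z' : Fin M → α, -f (Z' i)
        ∂(Measure.pi fun _ : Fin M => q.toMeasure))
      ((‖b - -b‖₊ / 2) ^ 2) (Measure.pi fun _ : Fin M => q.toMeasure) :=
    ProbabilityTheory.hasSubgaussianMGF_of_mem_Icc
      (X := fun Z : Fin M → α => -f (Z i))
      ((Measurable.of_discrete (f := fun a => -f a)).comp (measurable_pi_apply i)).aemeasurable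
      (Filter.Eventually.of_forall fun Z => by
        have := abs_le.1 (hf (Z i))
        constructor <;> linarith)
  have hint (i : Fin M) : ∫ Z' : Fin M → α, -f (Z' i)
      ∂(Measure.pi fun _ : Fin M => q.toMeasure) = -expect q f := by
    rw [integral_comp_eval (μ := fun _ : Fin M => q.toMeasure) (f := fun a => -f a)
      Measurable.of_discrete.aestronglyMeasurable, integral_neg, expect_eq_integral]
  simp only [hint] at hsub
  have hind := ProbabilityTheory.iIndepFun_pi (μ := fun _ : Fin M => q.toMeasure)
    (X := fun _ a => -f a - -expect q f) fun _ => Measurable.of_discrete.aemeasurable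
  have h := ProbabilityTheory.HasSubgaussianMGF.measure_sum_ge_le_of_iIndepFun hind
    (s := Finset.univ) (fun i _ => hsub i) (ε := M * s) (by positivity)
  have hset : {Z : Fin M → α | ∑ i, f (Z i) + M * s ≤ M * expect q f} =
      {Z | (M : ℝ) * s ≤ ∑ i, (-f (Z i) - -expect q f)} := by
    ext Z
    simp only [Set.mem_ofPred_eq, Finset.sum_sub_distrib, Finset.sum_neg_distrib,
      Finset.sum_const, Finset.card_univ, Fintype.card_fin, nsmul_eq_mul]
    constructor <;> intro h' <;> linarith
  rw [hset]
  refine h.trans (le_of_eq ?_)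
  congr 1
  -- An interval of length `2b` has variance proxy `(2b/2)² = b²`.
  have hc : ((∑ _i : Fin M, (‖b - -b‖₊ / 2) ^ 2 : NNReal) : ℝ) = M * b ^ 2 := by
    simp only [Finset.sum_const, Finset.card_univ, Fintype.card_fin, nsmul_eq_mul]
    push_cast
    rw [Real.norm_eq_abs, sub_neg_eq_add, abs_of_pos (by positivity)]
    ring
  rw [hc]
  rcases Nat.eq_zero_or_pos M with rfl | hM
  · simp
  · have : (0 : ℝ) < M := by exact_mod_cast hM
    field_simp

/-! ### Discretisation of the weights. -/

section Net

variable {V : Type*}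

theorem abs_sub_le_of_floor_eq {K : ℕ} (hK : 0 < K) {x y : ℝ} (hx : 0 ≤ x) (hy : 0 ≤ y)
    (h : ⌊x * K⌋₊ = ⌊y * K⌋₊) : |x - y| ≤ 1 / K := by
  have hK' : (0 : ℝ) < K := by exact_mod_cast hK
  have h1 := Nat.floor_le (mul_nonneg hx hK'.le)
  have h2 := Nat.floor_le (mul_nonneg hy hK'.le)
  have h3 := Nat.lt_floor_add_one (x * K)
  have h4 := Nat.lt_floor_add_one (y * K)
  rw [h] at h1 h3
  have h5 : |x - y| * K = |x * K - y * K| := by rw [← sub_mul, abs_mul, abs_of_pos hK']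
  rw [le_div_iff₀ hK', h5, abs_le]
  constructor <;> linarith

/-- A set of weights in the unit interval has a net indexed by `m`-tuples of grid points. -/
theorem exists_weight_net (G : Digraph V) {W : Set (V → V → ℝ)} (hW : W.Nonempty)
    (h01 : ∀ w ∈ W, ∀ u v, G.Adj u v → w u v ∈ Set.Icc (0 : ℝ) 1) {K : ℕ} (hK : 0 < K) :
    ∃ rep : ({e : V × V // G.Adj e.1 e.2} → Fin (K + 1)) → V → V → ℝ,
      (∀ c, rep c ∈ W) ∧
        ∀ w ∈ W, ∃ c, ∀ u v, G.Adj u v → |w u v - rep c u v| ≤ 1 / K := by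
  classical
  obtain ⟨w₀, hw₀⟩ := hW
  let IsCode (c : {e : V × V // G.Adj e.1 e.2} → Fin (K + 1)) (w : V → V → ℝ) : Prop :=
    w ∈ W ∧ ∀ e, ((c e : ℕ)) = ⌊w e.1.1 e.1.2 * K⌋₊
  -- Each occupied grid cell is represented by one of its own members, so the net stays inside `W`;
  -- empty cells get the default `w₀`.
  refine ⟨fun c => if h : ∃ w, IsCode c w then h.choose else w₀, fun c => ?_, fun w hw => ?_⟩
  · dsimp only
    split_ifs with h
    · exact h.choose_spec.1
    · exact hw₀
  -- The weight 1 has floor `K`, hence `K + 1` code values per edge.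
  · have hlt (e : {e : V × V // G.Adj e.1 e.2}) : ⌊w e.1.1 e.1.2 * K⌋₊ < K + 1 := by
      refine Nat.lt_succ_of_le (Nat.floor_le_of_le ?_)
      exact mul_le_of_le_one_left (Nat.cast_nonneg K) (h01 w hw _ _ e.2).2
    refine ⟨fun e => ⟨_, hlt e⟩, fun u v huv => ?_⟩
    have h : ∃ w', IsCode (fun e => ⟨_, hlt e⟩) w' := ⟨w, hw, fun _ => rfl⟩
    dsimp only
    rw [dif_pos h]
    have hs := h.choose_spec
    exact abs_sub_le_of_floor_eq hK (h01 w hw u v huv).1 (h01 _ hs.1 u v huv).1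
      (hs.2 ⟨(u, v), huv⟩)

theorem card_codes [Fintype V] (G : Digraph V) (K : ℕ) [Fintype {e : V × V // G.Adj e.1 e.2}]
    [DecidableEq {e : V × V // G.Adj e.1 e.2}] :
    Fintype.card ({e : V × V // G.Adj e.1 e.2} → Fin (K + 1)) = (K + 1) ^ numEdges G := by
  classical
  rw [Fintype.card_fun, Fintype.card_fin, Fintype.card_subtype, numEdges]

end Net

/-- The sample size bound beats the size of the net of weights. -/
theorem sample_size_bounds {n m M : ℕ} (hn : 1 ≤ n) (hm : 1 ≤ m) {r ε δ : ℝ} (hr : 0 < r)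
    (hr1 : r ≤ 1) (hε : 0 < ε) (hε1 : ε < 1) (hδ : 0 < δ)
    (hM : 400 * ((n : ℝ) ^ 3 * m / (ε ^ 2 * r ^ 4)) *
      Real.log (2 + n + m + 1 / ε + 1 / δ + 1 / r) ^ 1 ≤ M) :
    4 ≤ M * ε ∧ ((⌈16 * (n : ℝ) ^ 2 * 2 ^ n / (ε * r)⌉₊ : ℝ) + 1) ^ m *
      Real.exp (-(M * (ε / 2) ^ 2) / (2 * (2 / r) ^ 2)) ≤ δ := by
  set X : ℝ := 2 + n + m + 1 / ε + 1 / δ + 1 / r with hX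
  have hn' : (1 : ℝ) ≤ n := by exact_mod_cast hn
  have hm' : (1 : ℝ) ≤ m := by exact_mod_cast hm
  have e0 : 0 < 1 / ε := by positivity
  have d0 : 0 < 1 / δ := by positivity
  have r0 : 0 < 1 / r := by positivity
  have e1 : 1 ≤ 1 / ε := by rw [le_div_iff₀ hε]; linarith
  have r1 : 1 ≤ 1 / r := by rw [le_div_iff₀ hr]; linarith
  have hX2 : 2 ≤ X := by linarith
  have hX0 : 0 < X := by linarith
  have hlog : 1 / 2 ≤ Real.log X := by
    have := Real.log_two_gt_d9
    have := Real.log_le_log two_pos hX2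
    linarith
  have hXn : (n : ℝ) ≤ X := by linarith
  have hXε : 1 / ε ≤ X := by linarith
  have hXδ : 1 / δ ≤ X := by linarith
  have hXr : 1 / r ≤ X := by linarith
  clear_value X
  set L := Real.log X with hL
  have hrr : r ^ 2 ≤ 1 := pow_le_one₀ hr.le hr1
  have hnm : (n : ℝ) * m ≤ n ^ 3 * m := by
    gcongr
    exact le_self_pow₀ hn' (by norm_num)
  -- The surplus factors `n²` and `1/r²` of the sample bound are discarded here.
  have hMlow : 400 * (n * m) * L ≤ M * (ε ^ 2 * r ^ 2) := by
    have h1 : 400 * ((n : ℝ) ^ 3 * m) * L ≤ M * (ε ^ 2 * r ^ 4) := by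
      rw [pow_one, mul_div_assoc', div_mul_eq_mul_div, div_le_iff₀ (by positivity)] at hM
      exact hM
    have h2 : M * (ε ^ 2 * r ^ 4) ≤ M * (ε ^ 2 * r ^ 2) := by
      gcongr ?_ * (?_ * ?_)
      exact pow_le_pow_of_le_one hr.le hr1 (by norm_num)
    have h3 : 400 * ((n : ℝ) * m) * L ≤ 400 * ((n : ℝ) ^ 3 * m) * L := by gcongr
    linarith
  have hnm1 : (1 : ℝ) ≤ n * m := one_le_mul_of_one_le_of_one_le hn' hm'
  constructor
  · have h1 : (M : ℝ) * (ε ^ 2 * r ^ 2) ≤ M * ε := by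
      gcongr
      calc ε ^ 2 * r ^ 2 ≤ ε ^ 2 * 1 := by gcongr
        _ ≤ ε := by nlinarith
    have h2 : 400 * 1 * (1 / 2) ≤ 400 * ((n : ℝ) * m) * L := by gcongr
    linarith
  -- With `Y = n² 2ⁿ / (ε r) ≥ 1`, the left side is at most `16 Y + 2 ≤ 2⁵ Y`, and each factor is
  -- bounded by a power of `X`.
  · have hK : (⌈16 * (n : ℝ) ^ 2 * 2 ^ n / (ε * r)⌉₊ : ℝ) + 1 ≤ X ^ (n + 9) := by
      have h1 := (Nat.ceil_lt_add_one
        (show (0 : ℝ) ≤ 16 * (n : ℝ) ^ 2 * 2 ^ n / (ε * r) by positivity)).le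
      have h2 : 16 * (n : ℝ) ^ 2 * 2 ^ n / (ε * r) =
          16 * ((n : ℝ) ^ 2 * 2 ^ n * ((1 / ε) * (1 / r))) := by field_simp
      have h3 : 1 ≤ (n : ℝ) ^ 2 * 2 ^ n * ((1 / ε) * (1 / r)) :=
        one_le_mul_of_one_le_of_one_le (one_le_mul_of_one_le_of_one_le (one_le_pow₀ hn')
          (one_le_pow₀ one_le_two)) (one_le_mul_of_one_le_of_one_le e1 r1)
      have h4 : (2 : ℝ) ^ 5 * ((n : ℝ) ^ 2 * 2 ^ n * ((1 / ε) * (1 / r))) ≤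
          X ^ 5 * (X ^ 2 * X ^ n * (X * X)) := by
        gcongr
      have h5 : X ^ 5 * (X ^ 2 * X ^ n * (X * X)) = X ^ (n + 9) := by ring
      linarith
    have hδX : 1 ≤ X * δ := by rwa [div_le_iff₀ hδ] at hXδ
    have hpow : (X ^ (n + 9)) ^ m ≤ δ * X ^ (11 * (n * m)) := by
      have h1 : (n + 9) * m + 1 ≤ 11 * (n * m) := by nlinarith [Nat.mul_le_mul hn hm]
      calc (X ^ (n + 9)) ^ m = X ^ ((n + 9) * m) * 1 := by rw [pow_mul, mul_one]
        _ ≤ X ^ ((n + 9) * m) * (X * δ) := by gcongr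
        _ = δ * X ^ ((n + 9) * m + 1) := by ring
        _ ≤ δ * X ^ (11 * (n * m)) := by
          gcongr
          linarith
    -- The Hoeffding exponent is `M ε² r² / 32 ≥ (400 / 32) n m L`, and `400 / 32 ≥ 11`.
    have hexp : Real.exp (-(M * (ε / 2) ^ 2) / (2 * (2 / r) ^ 2)) ≤
        (X ^ (11 * (n * m)))⁻¹ := by
      rw [← Real.exp_log (show 0 < X ^ (11 * (n * m)) by positivity), ← Real.exp_neg,
        Real.exp_le_exp, Real.log_pow]
      have : -(M * (ε / 2) ^ 2) / (2 * (2 / r) ^ 2) = -(M * (ε ^ 2 * r ^ 2) / 32) := by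
        field_simp
        ring
      rw [this]
      push_cast
      have : 0 ≤ (n : ℝ) * m * L := by positivity
      linarith
    calc _ ≤ (X ^ (n + 9)) ^ m * (X ^ (11 * (n * m)))⁻¹ := by gcongr
      _ ≤ δ * X ^ (11 * (n * m)) * (X ^ (11 * (n * m)))⁻¹ := by gcongr
      _ = δ := mul_inv_cancel_right₀ (by positivity) _

/-! ### Empirical risk minimisation. -/

section Learner

variable {V : Type*} [Fintype V] [DecidableEq V]

/-- Approximate empirical risk minimisers exist. -/
theorem exists_approx_minimizer {α : Type*} {W : Set α} (hW : W.Nonempty) {f : α → ℝ}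
    (hf : ∀ a, 0 ≤ f a) : ∃ a ∈ W, ∀ b ∈ W, f a ≤ f b + 1 := by
  have hb : BddBelow (f '' W) := ⟨0, by rintro _ ⟨a, -, rfl⟩; exact hf a⟩
  obtain ⟨_, ⟨a, ha, rfl⟩, h⟩ := Real.lt_sInf_add_pos (hW.image f) one_pos
  exact ⟨a, ha, fun b hb' => by linarith [csInf_le hb ⟨b, hb', rfl⟩]⟩

theorem obsLoss_nonneg (r : ℝ) (F : Finset V → V → ℝ) (z : Finset V × Finset V) :
    0 ≤ obsLoss r F z := by
  refine mul_nonneg (by positivity) (Finset.sum_nonneg fun v _ => ?_)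
  split_ifs
  · rfl
  all_goals exact sq_nonneg _

theorem admissible_mem_Icc {V : Type*} [Fintype V] {G : Digraph V} {lam : ℝ} (hlam : 0 < lam) {w : V → V → ℝ}
    (hw : w ∈ admissible G lam) (u v : V) (h : G.Adj u v) : w u v ∈ Set.Icc (0 : ℝ) 1 := by
  have := hw.1 u v h
  exact ⟨by linarith [this.1], by linarith [this.2]⟩

/-- An approximate minimiser `ŵ` of the empirical loss whose excess error is large is close to a
weight `w'` whose empirical excess loss is far below its mean. -/
theorem sum_obsLoss_add_le_of_excess (G : Digraph V) {w w' wh : V → V → ℝ} {r : unitInterval}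
    (hr : 0 < (r : ℝ)) (P : PMF (Finset V)) {M : ℕ} {Z : Fin M → Finset V × Finset V} {ε τ : ℝ}
    (hτ : 0 ≤ τ) (hτε : τ * (2 / r) ≤ ε / 8) (hMε : 4 ≤ M * ε)
    (hmin : ∑ i, obsLoss r (influence G wh) (Z i) ≤ ∑ i, obsLoss r (influence G w) (Z i) + 1)
    (hclose : ∀ S v, |influence G w' S v - influence G wh S v| ≤ τ)
    (hexc : ε ≤ errSq G w P (influence G wh) - errSq G w P (influence G w)) :
    ∑ i, (obsLoss r (influence G w') (Z i) - obsLoss r (influence G w) (Z i)) + M * (ε / 2) ≤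
      M * expect (incompleteCascade G w r P) fun z =>
        obsLoss r (influence G w') z - obsLoss r (influence G w) z := by
  have hd (z) := abs_le.1 (abs_obsLoss_sub_le hr r.2.2 (influence_mem_Icc G w')
    (influence_mem_Icc G wh) hτ hclose z)
  have hE : expect (incompleteCascade G w r P) (fun z =>
        obsLoss r (influence G wh) z - obsLoss r (influence G w) z) ≤
      expect (incompleteCascade G w r P) (fun z =>
        obsLoss r (influence G w') z - obsLoss r (influence G w) z) + ε / 8 :=
    expect_le_expect_add _ fun z => by linarith [(hd z).1]
  rw [expect_incompleteCascade_obsLoss_sub G w hr P fun S v hv => by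
    rw [influence_of_mem G wh hv, influence_of_mem G w hv]] at hE
  have hS : ∑ i, obsLoss r (influence G w') (Z i) ≤
      ∑ i, (obsLoss r (influence G wh) (Z i) + ε / 8) :=
    Finset.sum_le_sum fun i _ => by linarith [(hd (Z i)).2]
  simp only [Finset.sum_add_distrib, Finset.sum_const, Finset.card_univ, Fintype.card_fin,
    nsmul_eq_mul] at hS
  rw [Finset.sum_sub_distrib]
  -- Error budget: `M ε / 8` for rounding in the mean, `M ε / 8` in the sample, and `1 ≤ M ε / 4`
  -- for approximate minimisation; with the deviation `M ε / 2` this totals `M ε`.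
  have hmul := mul_le_mul_of_nonneg_left (hexc.trans hE) (Nat.cast_nonneg (α := ℝ) M)
  rw [mul_add] at hmul
  linarith

/-- A net of weights yields a uniform bound for approximate empirical risk minimisation. -/
theorem trainingLaw_excess_le (G : Digraph V) {W : Set (V → V → ℝ)}
    (h01 : ∀ w ∈ W, ∀ u v, G.Adj u v → w u v ∈ Set.Icc (0 : ℝ) 1) {w : V → V → ℝ} (hw : w ∈ W)
    {r : unitInterval} (hr : 0 < (r : ℝ)) (P : PMF (Finset V)) {M : ℕ} {ε : ℝ} (hε : 0 < ε)
    (hMε : 4 ≤ M * ε) {K : ℕ} (hK : 0 < K)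
    (hKε : 16 * (Fintype.card V : ℝ) ^ 2 * 2 ^ Fintype.card V / (ε * r) ≤ K)
    {wh : (Fin M → Finset V × Finset V) → V → V → ℝ} (hwh : ∀ Z, wh Z ∈ W)
    (hmin : ∀ Z, ∑ i, obsLoss r (influence G (wh Z)) (Z i) ≤
      ∑ i, obsLoss r (influence G w) (Z i) + 1) :
    (trainingLaw G w r P M).real
      {Z | ε ≤ errSq G w P (influence G (wh Z)) - errSq G w P (influence G w)} ≤
      ((K : ℝ) + 1) ^ numEdges G * Real.exp (-(M * (ε / 2) ^ 2) / (2 * (2 / (r : ℝ)) ^ 2)) := by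
  classical
  obtain ⟨rep, hrep, hnet⟩ := exists_weight_net G ⟨w, hw⟩ h01 hK
  set τ : ℝ := (Fintype.card V : ℝ) ^ 2 * 2 ^ Fintype.card V * (1 / K) with hτ
  have hK' : (0 : ℝ) < K := by exact_mod_cast hK
  -- This requirement on the mesh is the origin of the constant 16 in the bound on `K`.
  have hτε : τ * (2 / r) ≤ ε / 8 := by
    rw [div_le_iff₀ (by positivity)] at hKε
    rw [hτ, mul_one_div, div_mul_div_comm, div_le_iff₀ (by positivity)]
    linarith
  have hτ0 : 0 ≤ τ := by positivity
  have : IsFiniteMeasure (trainingLaw G w r P M) := by unfold trainingLaw; infer_instance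
  let g (c) (z : Finset V × Finset V) : ℝ :=
    obsLoss r (influence G (rep c)) z - obsLoss r (influence G w) z
  let D (c) : Set (Fin M → Finset V × Finset V) :=
    {Z | ∑ i, g c (Z i) + M * (ε / 2) ≤ M * expect (incompleteCascade G w r P) (g c)}
  have hmono : {Z | ε ≤ errSq G w P (influence G (wh Z)) - errSq G w P (influence G w)} ⊆
      ⋃ c, D c := by
    intro Z hZ
    obtain ⟨c, hc⟩ := hnet (wh Z) (hwh Z)
    refine Set.mem_iUnion.2 ⟨c, sum_obsLoss_add_le_of_excess G hr P hτ0 hτε hMε (hmin Z)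
      (fun S v => ?_) hZ⟩
    rw [abs_sub_comm]
    exact abs_influence_sub_le G (by positivity) hc S v
  have hD (c) : (trainingLaw G w r P M).real (D c) ≤
      Real.exp (-(M * (ε / 2) ^ 2) / (2 * (2 / (r : ℝ)) ^ 2)) := by
    refine measureReal_pi_sum_add_le (incompleteCascade G w r P) (by positivity) (fun z => ?_) M
      (by positivity)
    have h1 (S : Finset V) (v : V) : |influence G (rep c) S v - influence G w S v| ≤ 1 := by
      have h2 := influence_mem_Icc G (rep c) S v
      have h3 := influence_mem_Icc G w S v
      exact abs_le.2 ⟨by linarith [h2.1, h3.2], by linarith [h2.2, h3.1]⟩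
    exact (abs_obsLoss_sub_le hr r.2.2 (influence_mem_Icc G (rep c))
      (influence_mem_Icc G w) zero_le_one h1 z).trans_eq (one_mul _)
  calc _ ≤ ∑ c, (trainingLaw G w r P M).real (D c) :=
        (measureReal_mono hmono).trans (measureReal_iUnion_fintype_le D)
    _ ≤ _ := Finset.sum_le_sum fun c _ => hD c
    _ = _ := by
      rw [Finset.sum_const, Finset.card_univ, card_codes, nsmul_eq_mul]
      push_cast
      rfl

/-- The Lipschitz bound with `η = 0`: its hypothesis is vacuous without edges. -/
theorem influence_eq_of_numEdges_eq_zero {G : Digraph V} (hG : numEdges G = 0)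
    (w w' : V → V → ℝ) : influence G w = influence G w' := by
  classical
  have hA (u v : V) : ¬ G.Adj u v := fun h => by
    have := Finset.card_eq_zero.1 hG
    simpa [h] using Finset.ext_iff.1 this (u, v)
  ext S v
  have h := abs_influence_sub_le G (w := w) (w' := w') le_rfl (fun u v h => (hA u v h).elim) S v
  rw [mul_zero] at h
  exact sub_eq_zero.1 (abs_nonpos_iff.1 h)

theorem card_pos_of_numEdges_pos {V : Type*} [Fintype V] {G : Digraph V} (hG : 0 < numEdges G) : 0 < Fintype.card V := by
  obtain ⟨e, -⟩ := Finset.card_pos.1 hG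
  exact Fintype.card_pos_iff.2 ⟨e.1⟩

end Learner

end DLT

theorem theorem2 :
    ∃ (C : ℝ) (k : ℕ), 0 < C ∧
      ∀ (V : Type*) [Fintype V] [DecidableEq V] (G : Digraph V) (lam : ℝ) (r : unitInterval),
        0 < lam → lam < 1 / 2 → 0 < (r : ℝ) →
        DLT.ProperlyPACLearnable G (DLT.admissible G lam) r fun ε δ =>
          C * ((Fintype.card V : ℝ) ^ 3 * (DLT.numEdges G : ℝ) / (ε ^ 2 * (r : ℝ) ^ 4)) *
            Real.log (2 + (Fintype.card V : ℝ) + (DLT.numEdges G : ℝ) +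
              1 / ε + 1 / δ + 1 / (r : ℝ)) ^ k := by
  refine ⟨400, 1, by norm_num, fun V _ _ G lam r hlam _ hr => ?_⟩
  by_cases hW : (DLT.admissible G lam).Nonempty
  swap
  · exact ⟨fun _ _ => 0, fun h => (hW h).elim, fun _ _ _ _ w hw => (hW ⟨w, hw⟩).elim⟩
  -- The slack 1 in the empirical sum does not involve `ε`, which the learner does not know.
  have herm (M : ℕ) (Z : Fin M → Finset V × Finset V) :=
    DLT.exists_approx_minimizer hW (f := fun w => ∑ i, DLT.obsLoss r (DLT.influence G w) (Z i))
      fun w => Finset.sum_nonneg fun i _ => DLT.obsLoss_nonneg _ _ _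
  choose wh hwh hmin using herm
  refine ⟨fun M Z => DLT.influence G (wh M Z), fun _ M Z => ⟨_, hwh M Z, rfl⟩, ?_⟩
  intro ε hε δ hδ w hw P M hM
  rcases Nat.eq_zero_or_pos (DLT.numEdges G) with hm | hm
  -- Without edges the sample bound is 0 and permits `M = 0`, but the class is a single function, so
  -- the excess error vanishes.
  · have h (Z) : DLT.influence G (wh M Z) = DLT.influence G w :=
      DLT.influence_eq_of_numEdges_eq_zero hm _ _
    simp [h, not_le.2 hε.1]
  have hn := DLT.card_pos_of_numEdges_pos hm
  obtain ⟨hMε, hδ'⟩ := DLT.sample_size_bounds hn hm hr r.2.2 hε.1 hε.2 hδ.1 hM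
  have hn' : (0 : ℝ) < Fintype.card V := by exact_mod_cast hn
  have hε0 := hε.1
  have hK : 0 < ⌈16 * (Fintype.card V : ℝ) ^ 2 * 2 ^ Fintype.card V / (ε * r)⌉₊ :=
    Nat.ceil_pos.2 (by positivity)
  have hle := (DLT.trainingLaw_excess_le G
    (fun w hw => DLT.admissible_mem_Icc hlam hw) hw hr P hε.1 hMε hK (Nat.le_ceil _) (hwh M)
    fun Z => hmin M Z w hw).trans hδ'
  have : IsFiniteMeasure (DLT.trainingLaw G w r P M) := by
    unfold DLT.trainingLaw; infer_instance
  rw [← ofReal_measureReal]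
  exact ENNReal.ofReal_le_ofReal hle
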